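/- Let $\Sigma$ be an alphabet with $|\Sigma| = 1$, let $N$ be a finite non-empty set of nonterminals and let $Q$ be a finite non-empty set of nodes. A context-free grammar $G$ with nonterminals $N$ over $\Sigma$ is a set of production rules, each of the form $a \to b\,c$ or $a \to \sigma$ with $a, b, c \in N$ and $\sigma \in \Sigma$; for $a \in N$, $L(G; a) \subseteq \Sigma^*$ is the set of strings that can be derived from $a$. A graph $\Gamma$ with nodes $Q$ is a set of labeled edges $E \subseteq Q \times \Sigma \times Q$; for $m, n \in Q$, $L(\Gamma; m, n) \subseteq \Sigma^*$ is the set of label sequences of paths from $m$ to $n$ (the empty path being allowed when $m = n$). For a non-empty language $L$, let $\mathrm{minlen}(L)$ be the length of a shortest string in $L$. Then: 1. (Upper bound.) For every such grammar $G$, every $a \in N$, every such graph $\Gamma$ and all $m, n \in Q$ such that $L = L(G; a) \cap L(\Gamma; m, n)$ is non-empty, $$\mathrm{minlen}(L) \le |Q|\,\bigl(2^{2|N|-1} + 1\bigr).$$ 2. (Worst-case lower bound.) There exist such a grammar $G$, $a \in N$, such a graph $\Gamma$ and $m, n \in Q$ such that $L = L(G; a) \cap L(\Gamma; m, n)$ is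 non-empty and $$|Q|\,2^{|N|-1} \le \mathrm{minlen}(L).$$ -/

import Mathlib

/-- A context-free grammar with nonterminals `N` over the alphabet `A`, without a dedicated start
symbol. Every production rule has the form `a → b c` or `a → σ` (Chomsky normal form). Nonterminals
and alphabet symbols are kept apart by Mathlib's type `Symbol A N`. -/
structure CFGrammar (N A : Type*) where
  /-- The production rules. -/
  rules : Set (ContextFreeRule A N)
  /-- Every right-hand side is a pair of nonterminals or a single alphabet symbol. -/
  normal : ∀ r ∈ rules,
    (∃ b c : N, r.output = [Symbol.nonterminal b, Symbol.nonterminal c]) ∨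
      ∃ s : A, r.output = [Symbol.terminal s]

namespace CFGrammar

/-- `u` is rewritten into `v` by one application of a production rule of `G`. -/
def Step {N A : Type*} (G : CFGrammar N A) (u v : List (Symbol A N)) : Prop :=
  ∃ r ∈ G.rules, r.Rewrites u v

/-- `u` is rewritten into `v` by finitely many (possibly zero) rewrite steps. -/
def Derives {N A : Type*} (G : CFGrammar N A) : List (Symbol A N) → List (Symbol A N) → Prop :=
  Relation.ReflTransGen G.Step

/-- The language `L(G; a)` of the grammar `G` with respect to the nonterminal `a`. -/
def language {N A : Type*} (G : CFGrammar N A) (a : N) : Language A :=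
  {w | G.Derives [Symbol.nonterminal a] (w.map Symbol.terminal)}

end CFGrammar

/-- A directed edge-labeled graph with nodes `Q` and labels in `A`, given by its edge set. -/
structure LabeledGraph (Q A : Type*) where
  /-- The labeled edges `(m, σ, n)`. -/
  edges : Set (Q × A × Q)

namespace LabeledGraph

/-- The set of nodes that can be reached from `m` by a path with trace `w`. -/
def reach {Q A : Type*} (Γ : LabeledGraph Q A) : Q → List A → Set Q
  | m, [] => {m}
  | m, s :: w => ⋃ n ∈ {n | (m, s, n) ∈ Γ.edges}, Γ.reach n w

/-- The language `L(Γ; m, n)` of traces of paths from `m` to `n`. -/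
def language {Q A : Type*} (Γ : LabeledGraph Q A) (m n : Q) : Language A :=
  {w | n ∈ Γ.reach m w}

end LabeledGraph

/-- The length of a shortest string of a language (only meaningful for a nonempty language). -/
noncomputable def minLength {A : Type*} (L : Language A) : ℕ :=
  sInf {k | ∃ w ∈ L, w.length = k}

/-! Over a one-letter alphabet a word is its length, so membership in `G.language a` only asks for a
parse tree with that many leaves (`mem_language_iff`).

Upper bound: if the parse tree of a shortest word has at least `|Q|` disjoint removable contexts,
dropping them one by one gives more than `|Q|` positions on the graph path. Two of these meet the
same node, so a cycle and contexts of the same total size can be cut (`exists_shorter_word`). Hence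
there are fewer than `|Q|` contexts, and `exists_pumpDecomposition` bounds a tree by the number of
contexts found in it: a tree without any has at most `2 ^ (|N| - 1)` leaves.

Lower bound: a doubling grammar with one looping rule produces exactly the lengths `2 ^ k + M * j`,
where `k = |N| - 1`. A graph cycle of length `d + 1` coprime to `M` forces `j ≡ d`, hence `j ≥ d`
(`le_of_modEq_of_coprime`). What remains is to choose the loop and a `d < |Q|` with a large enough
`M * d`. -/

namespace CFGrammar

/-! ### Unary words: derivations as leaf counts of parse trees -/

/-- `G.Yields a n` says that a parse tree of `G` with root `a` and `n` leaves exists. -/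
inductive Yields {N A : Type*} (G : CFGrammar N A) : N → ℕ → Prop
  | leaf {a : N} {s : A} (h : ⟨a, [Symbol.terminal s]⟩ ∈ G.rules) : Yields G a 1
  | node {a b c : N} {i j : ℕ}
      (h : ⟨a, [Symbol.nonterminal b, Symbol.nonterminal c]⟩ ∈ G.rules)
      (hb : Yields G b i) (hc : Yields G c j) : Yields G a (i + j)

/-- The possible numbers of leaves of forests whose roots are a given sentential form. -/
def YieldsForm {N A : Type*} (G : CFGrammar N A) : List (Symbol A N) → ℕ → Prop
  | [], n => n = 0
  | Symbol.terminal _ :: u, n => ∃ j, YieldsForm G u j ∧ n = 1 + j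
  | Symbol.nonterminal b :: u, n => ∃ i j, G.Yields b i ∧ YieldsForm G u j ∧ n = i + j

section Yields

variable {N A : Type*} {G : CFGrammar N A}

theorem Yields.pos {a : N} {n : ℕ} (h : G.Yields a n) : 0 < n := by
  induction h with
  | leaf => exact one_pos
  | node _ _ _ hb _ => omega

theorem yieldsForm_append (u v : List (Symbol A N)) (n : ℕ) :
    G.YieldsForm (u ++ v) n ↔ ∃ i j, G.YieldsForm u i ∧ G.YieldsForm v j ∧ n = i + j := by
  induction u generalizing n with
  | nil => simp [YieldsForm]
  | cons x u ih =>
    cases x with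
    | terminal s =>
      simp only [List.cons_append, YieldsForm, ih]
      constructor
      · rintro ⟨_, ⟨i, j, hi, hj, rfl⟩, rfl⟩
        exact ⟨1 + i, j, ⟨i, hi, rfl⟩, hj, by omega⟩
      · rintro ⟨_, j, ⟨i, hi, rfl⟩, hj, rfl⟩
        exact ⟨i + j, ⟨i, j, hi, hj, rfl⟩, by omega⟩
    | nonterminal b =>
      simp only [List.cons_append, YieldsForm, ih]
      constructor
      · rintro ⟨k, _, hk, ⟨i, j, hi, hj, rfl⟩, rfl⟩
        exact ⟨k + i, j, ⟨k, i, hk, hi, rfl⟩, hj, by omega⟩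
      · rintro ⟨_, j, ⟨k, i, hk, hi, rfl⟩, hj, rfl⟩
        exact ⟨k, i + j, hk, ⟨i, j, hi, hj, rfl⟩, by omega⟩

theorem yieldsForm_map_terminal (w : List A) :
    G.YieldsForm (w.map Symbol.terminal) w.length := by
  induction w with
  | nil => rfl
  | cons s w ih => exact ⟨_, ih, by simp [add_comm]⟩

theorem yields_of_rule {r : ContextFreeRule A N} (hr : r ∈ G.rules) {n : ℕ}
    (h : G.YieldsForm r.output n) : G.Yields r.input n := by
  obtain ⟨a, o⟩ := r
  rcases G.normal _ hr with ⟨b, c, ho⟩ | ⟨s, ho⟩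
  · obtain rfl : o = _ := ho
    obtain ⟨i, _, hi, ⟨j, _, hj, rfl, rfl⟩, rfl⟩ := h
    exact .node hr hi hj
  · obtain rfl : o = _ := ho
    obtain ⟨_, rfl, rfl⟩ := h
    exact .leaf hr

theorem yieldsForm_of_step {u v : List (Symbol A N)} (h : G.Step u v) {n : ℕ}
    (hv : G.YieldsForm v n) : G.YieldsForm u n := by
  obtain ⟨r, hr, h⟩ := h
  obtain ⟨p, q, rfl, rfl⟩ := h.exists_parts
  simp only [yieldsForm_append] at hv ⊢
  obtain ⟨_, k, ⟨i, j, hi, hj, rfl⟩, hk, rfl⟩ := hv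
  exact ⟨_, k, ⟨i, j, hi, ⟨j, 0, yields_of_rule hr hj, rfl, rfl⟩, rfl⟩, hk, rfl⟩

theorem yields_length_of_mem_language {a : N} {w : List A} (h : w ∈ G.language a) :
    G.Yields a w.length := by
  have key : G.YieldsForm [Symbol.nonterminal a] w.length := by
    refine Relation.ReflTransGen.head_induction_on (motive := fun u _ => G.YieldsForm u w.length)
      h (yieldsForm_map_terminal w) ?_
    intro u v huv _ ih
    exact yieldsForm_of_step huv ih
  obtain ⟨i, j, hi, rfl, hn⟩ := key
  rw [hn]
  exact hi

theorem Derives.append_left {u v : List (Symbol A N)} (h : G.Derives u v)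
    (p : List (Symbol A N)) : G.Derives (p ++ u) (p ++ v) :=
  Relation.ReflTransGen.lift (p ++ ·) (fun _ _ ⟨r, hr, h⟩ => ⟨r, hr, h.append_left p⟩) _ _ h

theorem Derives.append_right {u v : List (Symbol A N)} (h : G.Derives u v)
    (p : List (Symbol A N)) : G.Derives (u ++ p) (v ++ p) :=
  Relation.ReflTransGen.lift (· ++ p) (fun _ _ ⟨r, hr, h⟩ => ⟨r, hr, h.append_right p⟩) _ _ h

theorem derives_of_rule {r : ContextFreeRule A N} (hr : r ∈ G.rules) :
    G.Derives [Symbol.nonterminal r.input] r.output :=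
  .single ⟨r, hr, ContextFreeRule.Rewrites.input_output⟩

theorem mem_language_of_yields [Subsingleton A] {a : N} {n : ℕ} (h : G.Yields a n) :
    ∀ w : List A, w.length = n → w ∈ G.language a := by
  induction h with
  | @leaf a s hr =>
    intro w hw
    obtain ⟨t, rfl⟩ := List.length_eq_one_iff.1 hw
    obtain rfl := Subsingleton.elim s t
    exact derives_of_rule hr
  | @node a b c i j hr _ _ ihb ihc =>
    intro w hw
    have h₁ := ihb (w.take i) (by simp; omega)
    have h₂ := ihc (w.drop i) (by simp; omega)
    have h₃ := (Derives.append_right h₁ [Symbol.nonterminal c]).trans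
      (Derives.append_left h₂ ((w.take i).map Symbol.terminal))
    rw [← List.map_append, List.take_append_drop] at h₃
    exact (derives_of_rule hr).trans h₃

theorem mem_language_iff [Subsingleton A] {a : N} {w : List A} :
    w ∈ G.language a ↔ G.Yields a w.length :=
  ⟨yields_length_of_mem_language, fun h => mem_language_of_yields h w rfl⟩

end Yields

/-! ### Disjoint removable contexts and the size of a parse tree -/

section Pumping

variable {N A : Type*}

/-- A parse tree with root `a` containing disjoint removable contexts with `ps` many leaves and
`b` further leaves, together with a path from the root, labeled by `D`, that avoids these
contexts and has all of them below its end. -/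
structure PumpDecomposition (G : CFGrammar N A) (a : N) (b : ℕ) (ps : List ℕ) (D : Finset N) :
    Prop where
  pos : ∀ p ∈ ps, 0 < p
  yields : ∀ s : List ℕ, s.Sublist ps → G.Yields a (b + s.sum)
  path : ∀ d ∈ D, ∃ u b', u + b' = b ∧ (∀ i, G.Yields d i → G.Yields a (u + i)) ∧
    ∀ s : List ℕ, s.Sublist ps → G.Yields d (b' + s.sum)

variable {G : CFGrammar N A} {a x y : N} {b c j : ℕ} {ps qs : List ℕ} {D E : Finset N}

theorem PumpDecomposition.of_yields (hpos : ∀ p ∈ ps, 0 < p)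
    (h : ∀ s : List ℕ, s.Sublist ps → G.Yields a (b + s.sum)) : G.PumpDecomposition a b ps {a} := by
  refine ⟨hpos, h, fun d hd => ?_⟩
  obtain rfl := Finset.mem_singleton.1 hd
  exact ⟨0, b, by simp, by simp, h⟩

theorem PumpDecomposition.grow [DecidableEq N]
    (hr : ∀ i j, G.Yields x i → G.Yields y j → G.Yields a (i + j))
    (h : G.PumpDecomposition x b ps D) (hj : G.Yields y j) :
    G.PumpDecomposition a (b + j) ps (insert a D) := by
  have hy : ∀ s : List ℕ, s.Sublist ps → G.Yields a (b + j + s.sum) := fun s hs => by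
    simpa [add_right_comm] using hr _ _ (h.yields s hs) hj
  refine ⟨h.pos, hy, fun d hd => ?_⟩
  rcases Finset.mem_insert.1 hd with rfl | hd
  · exact ⟨0, b + j, by simp, by simp, hy⟩
  · obtain ⟨u, b', rfl, hu, hs⟩ := h.path d hd
    refine ⟨u + j, b', by omega, fun i hi => ?_, hs⟩
    simpa [add_right_comm] using hr _ _ (hu i hi) hj

/-- The root label recurs on the path. The part of the tree between the two occurrences is a new
context, disjoint from the old ones because these lie below the end of the path; it is nonempty
since it contains the sibling tree. -/
theorem PumpDecomposition.close
    (hr : ∀ i j, G.Yields x i → G.Yields y j → G.Yields a (i + j))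
    (h : G.PumpDecomposition x b ps D) (hj : G.Yields y j) (ha : a ∈ D) :
    ∃ p b', p + b' = b + j ∧ G.PumpDecomposition a b' (p :: ps) {a} := by
  obtain ⟨u, b', rfl, hu, hs⟩ := h.path a ha
  refine ⟨u + j, b', by omega, .of_yields ?_ ?_⟩
  · have := hj.pos
    simp only [List.mem_cons, forall_eq_or_imp]
    exact ⟨by omega, h.pos⟩
  · intro s hsub
    rcases List.sublist_cons_iff.1 hsub with hsub | ⟨t, rfl, ht⟩
    · exact hs s hsub
    · have := hr _ _ (hu _ (hs t ht)) hj
      rw [List.sum_cons]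
      convert this using 1
      omega

theorem PumpDecomposition.merge
    (hr : ∀ i j, G.Yields x i → G.Yields y j → G.Yields a (i + j))
    (hx : G.PumpDecomposition x b ps D) (hy : G.PumpDecomposition y c qs E) :
    G.PumpDecomposition a (b + c) (ps ++ qs) {a} := by
  refine .of_yields ?_ ?_
  · intro p hp
    exact (List.mem_append.1 hp).elim (hx.pos p) (hy.pos p)
  · intro s hs
    obtain ⟨s, t, rfl, hs, ht⟩ := List.sublist_append_iff.1 hs
    have := hr _ _ (hx.yields s hs) (hy.yields t ht)
    rw [List.sum_append]
    convert this using 1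
    omega

/-- The number of leaves of a tree is bounded in terms of the number `g` of disjoint contexts found
in it and of the length `l` of the remaining path, where `k` is the number of nonterminals. -/
def SizeBound (k n g l : ℕ) : Prop :=
  (g = 0 ∧ 2 * n ≤ 2 ^ l) ∨
    (0 < g ∧ n + 2 ^ (k - 1) * (2 * k - 1) ≤ 2 * k * 2 ^ (k - 1) * g + 2 ^ (k - 1) * l)

theorem two_mul_two_pow_pred {k : ℕ} (hk : 0 < k) : 2 * 2 ^ (k - 1) = 2 ^ k := by
  obtain ⟨k, rfl⟩ := Nat.exists_eq_succ_of_ne_zero hk.ne'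
  simp [pow_succ, mul_comm]

variable [Fintype N]

/-- The path continues into the child `x`. A new label lengthens it, which pays for the sibling's at
most `2 ^ (k - 1)` leaves, or for a doubling while no context exists; a repeated label closes a
context and restarts the path. -/
theorem PumpDecomposition.exists_extend
    (hr : ∀ i j, G.Yields x i → G.Yields y j → G.Yields a (i + j))
    (h : G.PumpDecomposition x b ps D) (hj : G.Yields y j)
    (hB : SizeBound (Fintype.card N) (b + ps.sum) ps.length D.card)
    (hj0 : ps = [] → j ≤ b) (hj1 : 2 * j ≤ 2 ^ Fintype.card N) :
    ∃ b' ps' D', b' + ps'.sum = b + ps.sum + j ∧ G.PumpDecomposition a b' ps' D' ∧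
      SizeBound (Fintype.card N) (b + ps.sum + j) ps'.length D'.card := by
  classical
  have hk : 0 < Fintype.card N := Fintype.card_pos_iff.2 ⟨a⟩
  have hE := two_mul_two_pow_pred hk
  have hDk : D.card ≤ Fintype.card N := Finset.card_le_univ D
  unfold SizeBound at hB ⊢
  set k := Fintype.card N
  set e := 2 ^ (k - 1) with he
  by_cases ha : a ∈ D
  · obtain ⟨p, b', hp, h'⟩ := h.close hr hj ha
    refine ⟨b', p :: ps, {a}, by simp; omega, h', Or.inr ⟨by simp, ?_⟩⟩
    rw [Finset.card_singleton, List.length_cons]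
    obtain ⟨m, hm⟩ := Nat.exists_eq_succ_of_ne_zero hk.ne'
    have h2k : 2 * k - 1 = 2 * m + 1 := by omega
    rw [h2k] at hB ⊢
    rcases hB with ⟨h0, hB⟩ | ⟨-, hB⟩
    · obtain rfl := List.length_eq_zero_iff.1 h0
      have := hj0 rfl
      have h2 : 2 ^ D.card ≤ 2 ^ k := Nat.pow_le_pow_right (by norm_num) hDk
      simp only [List.sum_nil, List.length_nil] at *
      rw [hm]
      push_cast
      nlinarith
    · have h3 : e * D.card ≤ e * k := Nat.mul_le_mul_left _ hDk
      rw [hm] at hB h3 ⊢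
      nlinarith
  · refine ⟨b + j, ps, insert a D, by omega, h.grow hr hj, ?_⟩
    rw [Finset.card_insert_of_notMem ha]
    rcases hB with ⟨h0, hB⟩ | ⟨h0, hB⟩
    · refine Or.inl ⟨h0, ?_⟩
      obtain rfl := List.length_eq_zero_iff.1 h0
      have := hj0 rfl
      simp only [List.sum_nil] at *
      rw [pow_succ]
      omega
    · refine Or.inr ⟨h0, ?_⟩
      rw [mul_add]
      omega

theorem exists_pumpDecomposition {n : ℕ} (h : G.Yields a n) :
    ∃ b ps D, b + ps.sum = n ∧ G.PumpDecomposition a b ps D ∧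
      SizeBound (Fintype.card N) n ps.length D.card := by
  induction h with
  | @leaf a s hr =>
    refine ⟨1, [], {a}, rfl, .of_yields (by simp) ?_, Or.inl ⟨rfl, by simp⟩⟩
    intro s hs
    obtain rfl := List.sublist_nil.1 hs
    exact .leaf hr
  | @node a x y i j hr hx hy ihx ihy =>
    have hxy : ∀ i j, G.Yields x i → G.Yields y j → G.Yields a (i + j) :=
      fun i j hi hj => .node hr hi hj
    have hyx : ∀ i j, G.Yields y i → G.Yields x j → G.Yields a (i + j) :=
      fun i j hi hj => by rw [add_comm]; exact .node hr hj hi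
    have hk : 0 < Fintype.card N := Fintype.card_pos_iff.2 ⟨a⟩
    obtain ⟨b, ps, D, rfl, hb, hB⟩ := ihx
    obtain ⟨c, qs, E, rfl, hc, hC⟩ := ihy
    have hD : 2 ^ D.card ≤ 2 ^ Fintype.card N :=
      Nat.pow_le_pow_right (by norm_num) (Finset.card_le_univ D)
    have hE : 2 ^ E.card ≤ 2 ^ Fintype.card N :=
      Nat.pow_le_pow_right (by norm_num) (Finset.card_le_univ E)
    by_cases hp : ps = []
    · have hB' : 2 * (b + ps.sum) ≤ 2 ^ D.card := by
        rcases hB with ⟨-, hB⟩ | ⟨h0, -⟩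
        · exact hB
        · simp [hp] at h0
      -- The path goes into the child that has contexts or, if neither has any, into a larger one,
      -- so that the size at most doubles.
      by_cases hle : qs = [] ∧ c < b
      · have hC' : 2 * (c + qs.sum) ≤ 2 ^ E.card := by
          rcases hC with ⟨-, hC⟩ | ⟨h0, -⟩
          · exact hC
          · simp [hle.1] at h0
        exact hb.exists_extend hxy hy hB (fun _ => by simp [hle.1]; omega) (by omega)
      · have := hc.exists_extend hyx hx hC
          (fun hq => by simp [hp]; by_contra hlt; exact hle ⟨hq, by omega⟩) (by omega)
        rwa [add_comm (c + qs.sum)] at this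
    · by_cases hq : qs = []
      · have hC' : 2 * (c + qs.sum) ≤ 2 ^ E.card := by
          rcases hC with ⟨-, hC⟩ | ⟨h0, -⟩
          · exact hC
          · simp [hq] at h0
        exact hb.exists_extend hxy hy hB (fun h => absurd h hp) (by omega)
      · have hB' := hB.resolve_left fun h => hp (List.length_eq_zero_iff.1 h.1)
        have hC' := hC.resolve_left fun h => hq (List.length_eq_zero_iff.1 h.1)
        refine ⟨b + c, ps ++ qs, {a}, by rw [List.sum_append]; omega, hb.merge hxy hc,
          Or.inr ⟨by rw [List.length_append]; omega, ?_⟩⟩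
        rw [Finset.card_singleton, List.length_append]
        have h₁ : 2 ^ (Fintype.card N - 1) * D.card ≤ 2 ^ (Fintype.card N - 1) * Fintype.card N :=
          Nat.mul_le_mul_left _ (Finset.card_le_univ D)
        have h₂ : 2 ^ (Fintype.card N - 1) * E.card ≤ 2 ^ (Fintype.card N - 1) * Fintype.card N :=
          Nat.mul_le_mul_left _ (Finset.card_le_univ E)
        obtain ⟨m, hm⟩ := Nat.exists_eq_succ_of_ne_zero hk.ne'
        have h2k : 2 * Fintype.card N - 1 = 2 * m + 1 := by omega
        rw [h2k] at hB' hC' ⊢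
        set e := 2 ^ (Fintype.card N - 1)
        have h₃ : e * Fintype.card N = e * m + e := by rw [hm, Nat.succ_eq_add_one]; ring
        -- Replacing two paths of at most `k` labels each by `{a}` loses at most `2k - 1` labels;
        -- the constant `e * (2k - 1)`, present in both bounds, covers exactly this.
        rw [mul_add (2 * Fintype.card N * e)]
        nlinarith [hB'.2, hC'.2]

/-- With contexts present, `l ≤ k ≤ 2k - 1` absorbs the path term, and `k ≤ 2 ^ (k - 1)` bounds the
coefficient of `g` by `2 ^ (2k - 1)`. -/
theorem SizeBound.le_mul {k n g l q : ℕ} (hk : 0 < k) (hl : l ≤ k) (h : SizeBound k n g l)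
    (hg : g < q) : n ≤ q * (2 ^ (2 * k - 1) + 1) := by
  obtain ⟨m, rfl⟩ := Nat.exists_eq_succ_of_ne_zero hk.ne'
  have h₁ : 2 * (m + 1) - 1 = m + (m + 1) := by omega
  have h₂ : m + 1 ≤ 2 ^ m := Nat.lt_two_pow_self
  have h₃ : 2 ^ (2 * (m + 1) - 1) = 2 * (2 ^ m * 2 ^ m) := by rw [h₁, pow_add, pow_succ]; ring
  rcases h with ⟨-, h⟩ | ⟨-, h⟩
  · have h₄ : 2 ^ l ≤ 2 ^ (m + 1) := Nat.pow_le_pow_right (by norm_num) hl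
    rw [pow_succ] at h₄
    rw [h₃]
    nlinarith
  · rw [h₃]
    simp only [Nat.succ_eq_add_one] at *
    rw [h₁] at h
    simp only [Nat.add_sub_cancel] at h
    have h₅ : 2 ^ m * l ≤ 2 ^ m * (m + 1) := Nat.mul_le_mul_left _ hl
    have h₆ : 2 * (m + 1) * 2 ^ m * g ≤ 2 * 2 ^ m * 2 ^ m * q := by gcongr
    nlinarith [Nat.zero_le (2 ^ m * m)]

end Pumping

end CFGrammar

/-! ### Cutting graph cycles: the upper bound -/

namespace LabeledGraph

variable {Q A : Type*} {Γ : LabeledGraph Q A}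

theorem mem_reach_cons {m n : Q} {s : A} {w : List A} :
    n ∈ Γ.reach m (s :: w) ↔ ∃ p, (m, s, p) ∈ Γ.edges ∧ n ∈ Γ.reach p w := by
  simp [reach]

theorem mem_reach_append {m n : Q} {u v : List A} :
    n ∈ Γ.reach m (u ++ v) ↔ ∃ p ∈ Γ.reach m u, n ∈ Γ.reach p v := by
  induction u generalizing m with
  | nil => simp [reach]
  | cons s u ih =>
    simp only [List.cons_append, mem_reach_cons, ih]
    constructor
    · rintro ⟨p, hp, r, hr, hn⟩
      exact ⟨r, ⟨p, hp, hr⟩, hn⟩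
    · rintro ⟨r, ⟨p, hp, hr⟩, hn⟩
      exact ⟨p, hp, r, hr, hn⟩

end LabeledGraph

theorem minLength_le {A : Type*} {L : Language A} {w : List A} (hw : w ∈ L) :
    minLength L ≤ w.length :=
  Nat.sInf_le ⟨w, hw, rfl⟩

theorem exists_length_eq_minLength {A : Type*} {L : Language A} (h : ∃ w, w ∈ L) :
    ∃ w ∈ L, w.length = minLength L :=
  Nat.sInf_mem (s := {k | ∃ w ∈ L, w.length = k}) (h.elim fun w hw => ⟨w.length, w, hw, rfl⟩)

/-- With as many disjoint contexts as graph nodes, some of them can be cut from the tree while a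
cycle of the same length is cut from the path. -/
theorem exists_shorter_word {A N Q : Type*} [Subsingleton A] [Fintype Q]
    {G : CFGrammar N A} {a : N} {Γ : LabeledGraph Q A} {m n : Q} {w : List A} {b : ℕ}
    {ps : List ℕ} {D : Finset N} (hw : w ∈ Γ.language m n)
    (h : G.PumpDecomposition a b ps D) (hb : b + ps.sum = w.length)
    (hQ : Fintype.card Q ≤ ps.length) :
    ∃ v ∈ G.language a ⊓ Γ.language m n, v.length < w.length := by
  have hcut : ∀ t, ∃ p, p ∈ Γ.reach m (w.take t) ∧ n ∈ Γ.reach p (w.drop t) := fun t => by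
    apply LabeledGraph.mem_reach_append.1
    rw [List.take_append_drop]
    exact hw
  choose f hf₁ hf₂ using hcut
  obtain ⟨i, j, hij, hfij⟩ : ∃ i j : Fin (ps.length + 1), i < j ∧
      f (b + (ps.take i).sum) = f (b + (ps.take j).sum) := by
    -- The positions need not match where the contexts sit in the tree: only lengths matter.
    obtain ⟨i, j, hne, he⟩ := Fintype.exists_ne_map_eq_of_card_lt
      (fun i : Fin (ps.length + 1) => f (b + (ps.take i).sum)) (by simp; omega)
    rcases lt_or_gt_of_ne hne with hlt | hlt
    · exact ⟨i, j, hlt, he⟩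
    · exact ⟨j, i, hlt, he.symm⟩
  have hi : (ps.take i).sum + (ps.drop i).sum = ps.sum := List.sum_take_add_sum_drop ps i
  have hj : (ps.take j).sum + (ps.drop j).sum = ps.sum := List.sum_take_add_sum_drop ps j
  have hlt : (ps.drop j).sum < (ps.drop i).sum := by
    have hil : (i : ℕ) < ps.length := lt_of_lt_of_le hij (Nat.lt_succ_iff.1 j.2)
    rw [List.drop_eq_getElem_cons hil, List.sum_cons]
    have hpos := h.pos _ (List.getElem_mem hil)
    have hsub : (ps.drop j).Sublist (ps.drop (i + 1)) := List.drop_sublist_drop_left ps hij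
    have := hsub.sum_le_sum (by simp)
    omega
  have hlen : (w.take (b + (ps.take i).sum) ++ w.drop (b + (ps.take j).sum)).length =
      b + (ps.take i ++ ps.drop j).sum := by
    rw [List.length_append, List.length_take, List.length_drop, List.sum_append]
    omega
  refine ⟨w.take (b + (ps.take i).sum) ++ w.drop (b + (ps.take j).sum),
    ⟨CFGrammar.mem_language_iff.2 ?_, ?_⟩, ?_⟩
  · rw [hlen]
    apply h.yields
    conv_rhs => rw [← List.take_append_drop i ps]
    exact (List.Sublist.refl _).append (List.drop_sublist_drop_left ps hij.le)
  · refine LabeledGraph.mem_reach_append.2 ⟨_, hf₁ _, ?_⟩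
    rw [hfij]
    exact hf₂ _
  · rw [hlen, List.sum_append]
    omega

theorem minLength_le_of_subsingleton {A N Q : Type*} [Subsingleton A] [Fintype N] [Fintype Q]
    (G : CFGrammar N A) (a : N) (Γ : LabeledGraph Q A) (m n : Q)
    (h : ∃ w, w ∈ G.language a ⊓ Γ.language m n) :
    minLength (G.language a ⊓ Γ.language m n) ≤
      Fintype.card Q * (2 ^ (2 * Fintype.card N - 1) + 1) := by
  obtain ⟨w, hw, hmin⟩ := exists_length_eq_minLength h
  obtain ⟨b, ps, D, hb, hd, hB⟩ :=
    CFGrammar.exists_pumpDecomposition (CFGrammar.mem_language_iff.1 hw.1)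
  rw [← hmin]
  refine hB.le_mul (Fintype.card_pos_iff.2 ⟨a⟩) (Finset.card_le_univ D) ?_
  by_contra hQ
  obtain ⟨v, hv, hlt⟩ := exists_shorter_word hw.2 hd hb (not_lt.1 hQ)
  have := minLength_le hv
  omega

/-! ### Graph cycles and doubling grammars for the lower bound -/

namespace LabeledGraph

/-- The directed cycle through the first `c` nodes. -/
def cycle {Q : Type*} (A : Type*) {q : ℕ} (e : Q ≃ Fin q) (c : ℕ) : LabeledGraph Q A where
  edges := {t | (e t.1 : ℕ) < c ∧ (e t.2.2 : ℕ) = ((e t.1 : ℕ) + 1) % c}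

theorem mem_reach_cycle_iff {Q A : Type*} {q : ℕ} (e : Q ≃ Fin q) {c : ℕ} (hc : c ≤ q)
    (w : List A) {m n : Q} (hm : (e m : ℕ) < c) :
    n ∈ (cycle A e c).reach m w ↔ (e n : ℕ) = ((e m : ℕ) + w.length) % c := by
  induction w generalizing m with
  | nil =>
    simp only [reach, Set.mem_singleton_iff, List.length_nil, add_zero, Nat.mod_eq_of_lt hm]
    rw [← Fin.ext_iff, e.apply_eq_iff_eq]
  | cons s w ih =>
    have hlt : ((e m : ℕ) + 1) % c < c := Nat.mod_lt _ (by omega)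
    rw [mem_reach_cons, List.length_cons]
    constructor
    · rintro ⟨p, ⟨-, hp⟩, hn⟩
      change (e p : ℕ) = ((e m : ℕ) + 1) % c at hp
      rw [(ih (by omega)).1 hn, hp, Nat.mod_add_mod]
      congr 1
      omega
    · intro hn
      refine ⟨e.symm ⟨((e m : ℕ) + 1) % c, by omega⟩, ⟨hm, by simp⟩, (ih (by simpa using hlt)).2 ?_⟩
      simp only [Equiv.apply_symm_apply]
      rw [hn, Nat.mod_add_mod]
      congr 1
      omega

end LabeledGraph

namespace CFGrammar

/-- The grammar with rules `i + 1 → i i`, `0 → σ` and `z → k k` on the nonterminals `0, …, k`. -/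
def doubling {N : Type*} (A : Type*) {k : ℕ} (e : N ≃ Fin (k + 1)) (z : Fin (k + 1)) :
    CFGrammar N A where
  rules := {r | (∃ b, (e r.input : ℕ) = e b + 1 ∧
      r.output = [Symbol.nonterminal b, Symbol.nonterminal b]) ∨
    ((e r.input : ℕ) = 0 ∧ ∃ s, r.output = [Symbol.terminal s]) ∨
    (e r.input = z ∧ r.output =
      [Symbol.nonterminal (e.symm (Fin.last k)), Symbol.nonterminal (e.symm (Fin.last k))])}
  normal := by
    rintro r (⟨b, -, h⟩ | ⟨-, h⟩ | ⟨-, h⟩)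
    · exact Or.inl ⟨b, b, h⟩
    · exact Or.inr h
    · exact Or.inl ⟨_, _, h⟩

variable {N A : Type*} {k : ℕ} (e : N ≃ Fin (k + 1)) (z : Fin (k + 1))

/-- Doubling rules respect the congruence, and the modulus is chosen so that the looping rule does
too: `2 ^ (k + 1) ≡ 2 ^ z`. -/
theorem Yields.modEq_of_doubling {a : N} {n : ℕ} (h : (doubling A e z).Yields a n) :
    n ≡ 2 ^ (e a : ℕ) [MOD 2 ^ (k + 1) - 2 ^ (z : ℕ)] := by
  have hz : 2 ^ (z : ℕ) ≤ 2 ^ (k + 1) := Nat.pow_le_pow_right (by norm_num) z.2.le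
  induction h with
  | @leaf a s h =>
    rcases h with ⟨b, -, h⟩ | ⟨h, -⟩ | ⟨-, h⟩
    · simp at h
    · simp only at h
      rw [h, pow_zero]
    · simp at h
  | @node a x y i j h hx hy ihx ihy =>
    refine (ihx.add ihy).trans ?_
    rcases h with ⟨b, hb, h⟩ | ⟨-, s, h⟩ | ⟨hz', h⟩
    · simp only [List.cons.injEq, Symbol.nonterminal.injEq, and_true] at h hb
      rw [h.1, h.2, hb, ← mul_two, ← pow_succ]
    · simp at h
    · simp only [List.cons.injEq, Symbol.nonterminal.injEq, and_true] at h hz'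
      rw [h.1, h.2, hz', Equiv.apply_symm_apply, Fin.val_last, ← mul_two, ← pow_succ]
      exact ((Nat.modEq_iff_dvd' hz).2 dvd_rfl).symm

theorem yields_doubling_of_le [Nonempty A] {i : ℕ} (hi : i < k + 1) {j n : ℕ}
    (h : (doubling A e z).Yields (e.symm ⟨i, hi⟩) (2 ^ i + n)) (hij : i ≤ j) (hj : j < k + 1) :
    (doubling A e z).Yields (e.symm ⟨j, hj⟩) (2 ^ j + n) := by
  have base : ∀ j (hj : j < k + 1), (doubling A e z).Yields (e.symm ⟨j, hj⟩) (2 ^ j) := by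
    intro j
    induction j with
    | zero =>
      intro hj
      exact .leaf (s := Classical.arbitrary A) (Or.inr (Or.inl ⟨by simp, _, rfl⟩))
    | succ j ih =>
      intro hj
      rw [pow_succ, mul_two]
      exact .node (Or.inl ⟨_, by simp, rfl⟩) (ih (by omega)) (ih (by omega))
  induction j, hij using Nat.le_induction with
  | base => exact h
  | succ j _ ih =>
    rw [pow_succ, mul_two, add_assoc]
    exact .node (Or.inl ⟨_, by simp, rfl⟩) (base j (by omega)) (ih (by omega))

theorem yields_doubling_last [Nonempty A] (j : ℕ) :
    (doubling A e z).Yields (e.symm (Fin.last k))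
      (2 ^ k + (2 ^ (k + 1) - 2 ^ (z : ℕ)) * j) := by
  have hz : 2 ^ (z : ℕ) ≤ 2 ^ (k + 1) := Nat.pow_le_pow_right (by norm_num) z.2.le
  have up : ∀ n, (doubling A e z).Yields (e.symm ⟨z, z.2⟩) (2 ^ (z : ℕ) + n) →
      (doubling A e z).Yields (e.symm (Fin.last k)) (2 ^ k + n) := fun n hn =>
    yields_doubling_of_le e z z.2 hn (Nat.lt_succ_iff.1 z.2) (by omega)
  have base : (doubling A e z).Yields (e.symm (Fin.last k)) (2 ^ k + 0) :=
    yields_doubling_of_le e z (Nat.succ_pos k)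
      (.leaf (G := doubling A e z) (s := Classical.arbitrary A)
        (Or.inr (Or.inl ⟨by simp, _, rfl⟩))) (Nat.zero_le k)
      (by omega)
  induction j with
  | zero => exact base
  | succ j ih =>
    -- One more turn of the loop: `z → k k` gives `2 ^ (k + 1) + M * j = 2 ^ z + M * (j + 1)`, and
    -- climbing from `z` to `k` keeps the excess.
    apply up
    have := Yields.node (G := doubling A e z) (a := e.symm z) (Or.inr (Or.inr ⟨by simp, rfl⟩)) base ih
    convert this using 1
    rw [Nat.mul_add_one, pow_succ] at *
    omega

end CFGrammar

/-! ### Arithmetic of the lower bound -/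

/-- A length in the arithmetic progression `r, r + M, r + 2M, …` that agrees with its `d`-th term
modulo `d + 1` is at least that term. -/
theorem le_of_modEq_of_coprime {r M d l : ℕ} (hl : 0 < l) (hr : r ≤ M) (hM : l ≡ r [MOD M])
    (hc : l ≡ r + M * d [MOD d + 1]) (hcop : Nat.Coprime (d + 1) M) : r + M * d ≤ l := by
  have hrl : r ≤ l := by
    by_contra hlt
    have := (Nat.modEq_iff_dvd' (by omega)).1 hM
    have := Nat.le_of_dvd (by omega) this
    omega
  obtain ⟨j, hj⟩ := (Nat.modEq_iff_dvd' hrl).1 hM.symm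
  obtain rfl : l = r + M * j := by omega
  have h : j ≡ d [MOD d + 1] := Nat.ModEq.cancel_left_of_coprime hcop (hc.add_left_cancel' r)
  have hdj : d ≤ j := by
    have h₁ : j % (d + 1) = d := by rw [h, Nat.mod_eq_of_lt (Nat.lt_succ_self d)]
    have := Nat.mod_le j (d + 1)
    omega
  gcongr

theorem exists_le_minLength {A N Q : Type*} [Unique A] {k q : ℕ} (e : N ≃ Fin (k + 1))
    (f : Q ≃ Fin q) (z : Fin (k + 1)) {d : ℕ} (hd : d < q)
    (hcop : Nat.Coprime (d + 1) (2 ^ (k + 1) - 2 ^ (z : ℕ))) :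
    ∃ (G : CFGrammar N A) (a : N) (Γ : LabeledGraph Q A) (m n : Q),
      (∃ w, w ∈ G.language a ⊓ Γ.language m n) ∧
        2 ^ k + (2 ^ (k + 1) - 2 ^ (z : ℕ)) * d ≤
          minLength (G.language a ⊓ Γ.language m n) := by
  set M := 2 ^ (k + 1) - 2 ^ (z : ℕ) with hM
  have hlt : (2 ^ k + M * d) % (d + 1) < d + 1 := Nat.mod_lt _ (by omega)
  have hzk : 2 ^ (z : ℕ) ≤ 2 ^ k := Nat.pow_le_pow_right (by norm_num) (Nat.lt_succ_iff.1 z.2)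
  have hreach : ∀ w : List A, w ∈ (LabeledGraph.cycle A f (d + 1)).language
      (f.symm ⟨0, by omega⟩) (f.symm ⟨(2 ^ k + M * d) % (d + 1), by omega⟩) ↔
      (2 ^ k + M * d) % (d + 1) = w.length % (d + 1) := fun w => by
    refine (LabeledGraph.mem_reach_cycle_iff f hd w (by simp)).trans ?_
    simp
  have hne : ∃ w, w ∈ (CFGrammar.doubling A e z).language (e.symm (Fin.last k)) ⊓
      (LabeledGraph.cycle A f (d + 1)).language
      (f.symm ⟨0, by omega⟩) (f.symm ⟨(2 ^ k + M * d) % (d + 1), by omega⟩) := by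
    refine ⟨List.replicate (2 ^ k + M * d) default, CFGrammar.mem_language_iff.2 ?_,
      (hreach _).2 ?_⟩
    · rw [List.length_replicate]
      exact CFGrammar.yields_doubling_last e z d
    · rw [List.length_replicate]
  refine ⟨_, _, _, _, _, hne, ?_⟩
  obtain ⟨w, hw, hmin⟩ := exists_length_eq_minLength hne
  rw [← hmin]
  have hy := CFGrammar.mem_language_iff.1 hw.1
  have hmod := hy.modEq_of_doubling
  rw [Equiv.apply_symm_apply, Fin.val_last] at hmod
  exact le_of_modEq_of_coprime hy.pos (by rw [hM, pow_succ]; omega) hmod ((hreach w).1 hw.2).symm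
    hcop

/-- Among the numbers up to an even `q` there is a sufficiently large one coprime to
`2 ^ (k + 1) - 1`. -/
theorem exists_coprime_two_pow_sub_one {k q : ℕ} (hk : 0 < k) (hq : 0 < q) (heven : Even q) :
    ∃ d < q, Nat.Coprime (d + 1) (2 ^ (k + 1) - 1) ∧
      q * 2 ^ k ≤ 2 ^ k + (2 ^ (k + 1) - 1) * d := by
  obtain ⟨h, rfl⟩ := heven
  have hP : 2 ≤ 2 ^ k := by simpa using Nat.pow_le_pow_right (n := 2) (by norm_num) hk
  rw [pow_succ]
  set P := 2 ^ k
  obtain ⟨M, hM⟩ : ∃ M, P * 2 = M + 1 := ⟨P * 2 - 1, by omega⟩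
  rw [hM, Nat.add_sub_cancel]
  have hodd : Nat.Coprime 2 M := (Nat.coprime_two_left).2 ⟨P - 1, by omega⟩
  -- Here `M = 2P - 1` is odd. The cycle length `d + 1` is the largest power of two up to `q` for
  -- small `q`, then `M + 2`, then `M * n + 1` with `n` maximal.
  by_cases hsmall : h ≤ P
  · have h₁ : 2 ^ Nat.log 2 (h + h) ≤ h + h := Nat.pow_log_le_self 2 (by omega)
    have h₂ : h + h < 2 ^ (Nat.log 2 (h + h) + 1) := Nat.lt_pow_succ_log_self (by norm_num) _
    rw [pow_succ] at h₂
    refine ⟨2 ^ Nat.log 2 (h + h) - 1, by omega, ?_, ?_⟩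
    · rw [Nat.sub_add_cancel Nat.one_le_two_pow]
      exact hodd.pow_left _
    · have h₃ : h ≤ 2 ^ Nat.log 2 (h + h) - 1 := by omega
      have h₄ : M * h ≤ M * (2 ^ Nat.log 2 (h + h) - 1) := Nat.mul_le_mul_left _ h₃
      nlinarith
  · by_cases hmid : h + h ≤ 2 * M + 1
    · refine ⟨M + 1, by omega, ?_, ?_⟩
      · rw [show M + 1 + 1 = 2 + M from by omega, Nat.coprime_add_self_left]
        exact hodd
      · nlinarith
    · have hMpos : 0 < M := by omega
      have hdiv := Nat.div_add_mod (h + h - 1) M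
      have hlt := Nat.mod_lt (h + h - 1) hMpos
      have hn : 2 ≤ (h + h - 1) / M := (Nat.le_div_iff_mul_le hMpos).2 (by omega)
      set n := (h + h - 1) / M
      refine ⟨M * n, by omega, by simp, ?_⟩
      obtain ⟨R, hR⟩ : ∃ R, h + h = R + 1 := ⟨h + h - 1, by omega⟩
      rw [hR]
      obtain ⟨t, ht⟩ := Nat.exists_eq_add_of_le hn
      have h₁ : R + 1 ≤ M * n + M := by omega
      rw [ht] at h₁ ⊢
      have h₂ : (R + 1) * (M + 1) ≤ (M * (2 + t) + M) * (M + 1) := Nat.mul_le_mul_right _ h₁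
      have h₃ : 3 ≤ M := by omega
      nlinarith [Nat.mul_le_mul_left t h₃, Nat.mul_le_mul_left (t * M) h₃,
        Nat.mul_le_mul_left M h₃]

theorem mainTheorem7 {A N Q : Type*} [Fintype A] [Fintype N] [Nonempty N] [Fintype Q] [Nonempty Q]
    (hA : Fintype.card A = 1) :
    (∀ (G : CFGrammar N A) (a : N) (Γ : LabeledGraph Q A) (m n : Q),
      (∃ w, w ∈ G.language a ⊓ Γ.language m n) →
        minLength (G.language a ⊓ Γ.language m n) ≤
          Fintype.card Q * (2 ^ (2 * Fintype.card N - 1) + 1)) ∧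
    (∃ (G : CFGrammar N A) (a : N) (Γ : LabeledGraph Q A) (m n : Q),
      (∃ w, w ∈ G.language a ⊓ Γ.language m n) ∧
        Fintype.card Q * 2 ^ (Fintype.card N - 1) ≤
          minLength (G.language a ⊓ Γ.language m n)) := by

  have : Unique A := (Fintype.card_eq_one_iff_nonempty_unique.1 hA).some
  refine ⟨minLength_le_of_subsingleton, ?_⟩
  obtain ⟨k, hk⟩ := Nat.exists_eq_succ_of_ne_zero (Fintype.card_ne_zero (α := N))
  have hq : 0 < Fintype.card Q := Fintype.card_pos
  have e : N ≃ Fin (k + 1) := Fintype.equivFinOfCardEq hk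
  have f : Q ≃ Fin (Fintype.card Q) := Fintype.equivFin Q
  rw [hk, Nat.succ_sub_one]
  -- For odd `|Q|` or `k = 0` the loop `k → k k` has `M = 2 ^ k`, and the full cycle gives the bound
  -- exactly. Otherwise the loop `0 → k k` makes `M` odd.
  by_cases h : Nat.Coprime (Fintype.card Q) (2 ^ k)
  · have hsub : 2 ^ (k + 1) - 2 ^ ((Fin.last k : Fin (k + 1)) : ℕ) = 2 ^ k := by
      rw [Fin.val_last, pow_succ]
      omega
    have hq' : Fintype.card Q - 1 + 1 = Fintype.card Q := by omega
    have := exists_le_minLength (A := A) e f (Fin.last k) (d := Fintype.card Q - 1) (by omega)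
      (by rwa [hsub, hq'])
    rw [hsub, add_comm, ← Nat.mul_add_one, hq', mul_comm] at this
    exact this
  · have hk0 : 0 < k := by
      by_contra h0
      obtain rfl : k = 0 := by omega
      simp at h
    have heven : Even (Fintype.card Q) := by
      by_contra hodd
      exact h ((Nat.coprime_two_right.2 (Nat.not_even_iff_odd.1 hodd)).pow_right k)
    obtain ⟨d, hd, hcop, hle⟩ := exists_coprime_two_pow_sub_one hk0 hq heven
    obtain ⟨G, a, Γ, m, n, hne, hmin⟩ := exists_le_minLength (A := A) e f 0 hd
      (by simpa using hcop)
    exact ⟨G, a, Γ, m, n, hne, hle.trans (by simpa using hmin)⟩
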